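/- Setting. Let $X$ be a measurable input space, $\mathcal Z = X\times\{1,\dots,K\}$, and consider an $N$-qubit quantum classifier with the following data. The encoding circuit is a product $U_E(x)=\prod_{g=1}^{N_g}u_g(x)$ of unitary gates, each acting on at most $m$ qubits and depending measurably on $x$, of which $N_{ge}\ge 1$ are variational and the others do not depend on $x$; the encoded state is $\sigma(x)=U_E(x)(|0\rangle\langle 0|)^{\otimes N}U_E(x)^\dagger$. The ansatz $U(\theta)$ is an arbitrary family of unitaries on $N$ qubits with $\theta$ in an arbitrary parameter set $\Theta$. The measurement operators are $O^{(k)}=\mathbb I\otimes o^{(k)}$, $1\le k\le K$, where the $o^{(k)}$ are Hermitian operators on a subset of the qubits (fixed, or depending on $\theta$) with operator norm $\|o^{(k)}\|\le C_2$. The hypotheses are $h_\theta(x)=\big(\mathrm{Tr}(O^{(k)}U(\theta)\sigma(x)U(\theta)^\dagger)\big)_{k=1}^K\in\mathbb R^K$. Let $\ell(a,y)\ge 0$ be a per-sample loss such that, for every $\theta$ and $y$, $\ell(\cdot,y)$ is $L_1$-Lipschitz in the Euclidean norm on the set of outputs of $h_\theta$ (for example $\ell(a,y)=\frac12\|a-e_y\|_2^2$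 with $e_y$ the $y$-th unit vector and a suitable $L_1$). Let $n\ge1$, and let a learning algorithm assign to every training sample $\mathcal D=(z_1,\dots,z_n)\in\mathcal Z^n$ a hypothesis $\hat h=h_{\theta(\mathcal D)}$ (for example an empirical risk minimizer). Write $\ell(\hat h,(x,y))=\ell(\hat h(x),y)$. The algorithm is called $(R,\nu)$-robust if $\mathcal Z$ can be partitioned into $R$ disjoint measurable (possibly empty) sets $C_1,\dots,C_R$ such that for all $\mathcal D\in\mathcal Z^n$, all $s\in\mathcal D$, $z\in\mathcal Z$ and all $r$: if $s,z\in C_r$ then $|\ell(\hat h,s)-\ell(\hat h,z)|\le\nu(\mathcal D)$. Statement. Let $0<\epsilon\le 28N_{ge}$ and $R=\big\lfloor K(28N_{ge}/\epsilon)^{4^mN_{ge}}\big\rfloor$. Then the classifier is $(R,\,4L_1KC_2\epsilon)$-robust. Moreover, for every partition $C_1,\dots,C_R$ witnessing this robustness, every probability distribution $\mathbb D$ on $\mathcal Z$ and every $0<\delta<1$, with probability at least $1-\delta$ over an i.i.d. sample $\mathcal D$ of size $n$ from $\mathbb D$ (that is, outside a set of samples of outer probability at most $\delta$), the generalization error $\mathsf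 R_{\mathrm{Gene}}(\hat h)=\mathbb E_{z\sim\mathbb D}\,\ell(\hat h,z)-\frac1n\sum_{i=1}^n\ell(\hat h,z_i)$ satisfies both \[\mathsf R_{\mathrm{Gene}}(\hat h)\le 4L_1KC_2\epsilon+3\,\xi(\hat h)\sqrt{\frac{|\mathcal T_{\mathcal D}|4^mN_{ge}\ln\frac{56KN_{ge}}{\epsilon\delta}}{n}}+\xi(\hat h)\,\frac{2|\mathcal T_{\mathcal D}|4^mN_{ge}\ln\frac{56KN_{ge}}{\epsilon\delta}}{n}\] and \[\mathsf R_{\mathrm{Gene}}(\hat h)\le 4L_1KC_2\epsilon+5\,\xi(\hat h)\sqrt{\frac{|\mathcal T_{\mathcal D}|4^mN_{ge}\ln\frac{56KN_{ge}}{\epsilon\delta}}{n}},\] where $\xi(\hat h)=\sup_{z\in\mathcal Z}\ell(\hat h,z)$ and $\mathcal T_{\mathcal D}=\{r:|\{i:z_i\in C_r\}|\ge1\}$. The bounds do not involve the ansatz $U(\theta)$ or the number of trainable parameters. -/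

import Mathlib

open MeasureTheory
open scoped NNReal ENNReal

/-- Computational basis labels of the register formed by the qubits in `ι`; the Hilbert space of
the register is `ℂ ^ (Qubits ι)`, of dimension `2 ^ |ι|`. -/
abbrev Qubits (ι : Type) : Type := ι → Fin 2

/-- The operator on `N` qubits that acts as `A` on the qubits in `S` and as the identity on all
the other qubits, that is, `A ⊗ I` up to the ordering of the tensor factors. -/
def onQubits {N : ℕ} (S : Finset (Fin N)) (A : Matrix (Qubits S) (Qubits S) ℂ) :
    Matrix (Qubits (Fin N)) (Qubits (Fin N)) ℂ :=
  fun i j => if ∀ q, q ∉ S → i q = j q then A (fun q => i q) (fun q => j q) else 0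

/-- Spectral (operator) norm of a complex square matrix. -/
noncomputable def matrixOpNorm {ι : Type} [Fintype ι] [DecidableEq ι] (A : Matrix ι ι ℂ) : ℝ :=
  ‖Matrix.toEuclideanCLM (n := ι) (𝕜 := ℂ) A‖

/-- An encoding circuit on `N` qubits with inputs in `X`: a finite sequence of unitary gates, each
acting on at most `m` qubits. The gates in `variational` may depend on the input, the remaining
gates are fixed. -/
structure EncodingCircuit (X : Type*) [MeasurableSpace X] (N m : ℕ) where
  /-- total number of gates -/
  numGates : ℕ
  /-- the qubits on which a gate acts -/
  support : Fin numGates → Finset (Fin N)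
  card_support_le : ∀ g, (support g).card ≤ m
  /-- the gates, as functions of the input -/
  gate : (g : Fin numGates) → X → Matrix.unitaryGroup (Qubits (support g)) ℂ
  measurable_gate : ∀ g i j,
    Measurable fun x => (gate g x : Matrix (Qubits (support g)) (Qubits (support g)) ℂ) i j
  /-- the tunable (input-dependent) gates -/
  variational : Finset (Fin numGates)
  fixed : ∀ g, g ∉ variational → ∀ x x', gate g x = gate g x'

namespace EncodingCircuit

variable {X : Type*} [MeasurableSpace X] {N m : ℕ}

/-- The number of variational encoding gates. -/
def numVariational (E : EncodingCircuit X N m) : ℕ := E.variational.card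

/-- The encoding unitary: the product of all the gates. -/
def unitary (E : EncodingCircuit X N m) (x : X) :
    Matrix (Qubits (Fin N)) (Qubits (Fin N)) ℂ :=
  (List.ofFn fun g => onQubits (E.support g) (E.gate g x).1).prod

/-- The encoded state `U_E(x) (|0⟩⟨0|)^{⊗ N} U_E(x)†`. -/
noncomputable def state (E : EncodingCircuit X N m) (x : X) :
    Matrix (Qubits (Fin N)) (Qubits (Fin N)) ℂ :=
  E.unitary x * Matrix.single 0 0 1 * (E.unitary x).conjTranspose

end EncodingCircuit

/-- A `K`-class quantum classifier family on `N` qubits: an encoding circuit, an ansatz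
`U(θ)` with parameter `θ` in an arbitrary parameter space, and Hermitian local measurement
operators `o^(k)` acting on a set of measured qubits. The measurement operators may be trainable
too; fixed operators are the case of a constant function of `θ`. -/
structure QuantumClassifier (X : Type*) [MeasurableSpace X] (Θ : Type*) (N m K : ℕ) where
  encoding : EncodingCircuit X N m
  ansatz : Θ → Matrix.unitaryGroup (Qubits (Fin N)) ℂ
  /-- the qubits that are measured -/
  measured : Finset (Fin N)
  /-- the local measurement operators -/
  observable : Θ → Fin K → Matrix (Qubits measured) (Qubits measured) ℂ
  isHermitian_observable : ∀ θ k, (observable θ k).IsHermitian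

namespace QuantumClassifier

variable {X : Type*} [MeasurableSpace X] {Θ : Type*} {N m K : ℕ}

/-- The hypothesis `h_θ : X → ℝ^K`, with `k`-th entry `Tr(O^(k) U(θ) σ(x) U(θ)†)` where
`O^(k) = I ⊗ o^(k)` (a real number, since `O^(k)` is Hermitian). -/
noncomputable def predict (Q : QuantumClassifier X Θ N m K) (θ : Θ) (x : X) :
    EuclideanSpace ℝ (Fin K) :=
  WithLp.toLp 2 fun k =>
    (Matrix.trace (onQubits Q.measured (Q.observable θ k) *
      ((Q.ansatz θ).1 * Q.encoding.state x * (Q.ansatz θ).1.conjTranspose))).re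

/-- The loss of the hypothesis `h_θ` at the labelled example `z = (x, y)`. -/
noncomputable def loss (Q : QuantumClassifier X Θ N m K)
    (ℓ : EuclideanSpace ℝ (Fin K) → Fin K → ℝ) (θ : Θ) (z : X × Fin K) : ℝ :=
  ℓ (Q.predict θ z.1) z.2

end QuantumClassifier

section Learning

variable {Z : Type*} [MeasurableSpace Z] {n R : ℕ}

/-- The cells `C r` form a (measurable) partition of `Z` that witnesses the `(R, ν)`-robustness of
a learning algorithm: `loss D z` is the loss at `z` of the hypothesis that the algorithm returns on
the training sample `D`. Cells may be empty. -/
structure IsRobustPartition (loss : (Fin n → Z) → Z → ℝ) (ν : (Fin n → Z) → ℝ)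
    (C : Fin R → Set Z) : Prop where
  measurableSet : ∀ r, MeasurableSet (C r)
  disjoint : Pairwise fun r s => Disjoint (C r) (C s)
  cover : ⋃ r, C r = Set.univ
  robust : ∀ (D : Fin n → Z) (i : Fin n) (z : Z) (r : Fin R),
    D i ∈ C r → z ∈ C r → |loss D (D i) - loss D z| ≤ ν D

/-- `(R, ν)`-robustness of a learning algorithm. -/
def IsRobust (R : ℕ) (loss : (Fin n → Z) → Z → ℝ) (ν : (Fin n → Z) → ℝ) : Prop :=
  ∃ C : Fin R → Set Z, IsRobustPartition loss ν C

/-- The indices of the training examples that lie in the cell `C r`. -/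
def cellIndices (C : Fin R → Set Z) (D : Fin n → Z) (r : Fin R) : Set (Fin n) := {i | D i ∈ C r}

/-- The cells that contain at least one training example. -/
def occupiedCells (C : Fin R → Set Z) (D : Fin n → Z) : Set (Fin R) :=
  {r | 1 ≤ (cellIndices C D r).ncard}

/-- Expected risk minus empirical risk of a hypothesis with per-example loss `f`. -/
noncomputable def generalizationError (μ : Measure Z) (f : Z → ℝ) (D : Fin n → Z) : ℝ :=
  (∫ z, f z ∂μ) - (1 / (n : ℝ)) * ∑ i, f (D i)

/-- The largest loss of a hypothesis with per-example loss `f`. -/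
noncomputable def maxLoss (f : Z → ℝ) : ℝ := ⨆ z, f z

end Learning

/-! Robustness is a covering argument. Every unitary is `exp (i H)` with `H` Hermitian and `‖H‖ ≤
π`; such `H` form a ball in a real space of dimension at most `4 ^ m`, and `H ↦ exp (i H)` is
1-Lipschitz, so a volume count gives nets of size `(28 / r) ^ 4 ^ m` for each gate
(`exists_finset_cover_unitaryGroup`). Inputs whose variational gates share net labels have close
encoding unitaries by telescoping. In the Heisenberg picture the ansatz only contributes
contractions, so one partition by gate labels and class serves all `θ`.

Generalization compares cell probabilities `p r` with empirical frequencies `w r`. Up to `ν`, the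
error is at most the maximal loss times `∑ (p r - w r)⁺`, which equals `∑ (w r - p r)⁺` since both
families sum to one. The second sum sees occupied cells only. A one-sided Chernoff bound with
deviation proportional to `√(w r)`, a union bound over the fixed cells and Cauchy-Schwarz then give
the square root of the number of occupied cells. No independence between hypothesis and sample is
used. -/

/-! ### Covering balls in finite-dimensional normed spaces -/

/-- The balls of radius `η / 2` about the points are disjoint and lie in the ball of radius `ρ + η /
2`; compare Haar measures. -/
theorem card_mul_pow_le_of_separated {E : Type*} [NormedAddCommGroup E] [NormedSpace ℝ E]
    [FiniteDimensional ℝ E] {ρ η : ℝ} (hρ : 0 ≤ ρ) (hη : 0 < η) (s : Finset E)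
    (hs : ∀ c ∈ s, ‖c‖ ≤ ρ) (h : ∀ c ∈ s, ∀ d ∈ s, c ≠ d → η ≤ ‖c - d‖) :
    (s.card : ℝ) ≤ (1 + 2 * ρ / η) ^ Module.finrank ℝ E := by
  borelize E
  let μ : Measure E := Measure.addHaar
  have hδ : 0 < η / 2 := by positivity
  have hσ : 0 < ρ + η / 2 := by positivity
  have D : Set.Pairwise (s : Set E) (Function.onFun Disjoint fun c => Metric.ball (c : E) (η / 2)) := by
    rintro c hc d hd hcd
    apply Metric.ball_disjoint_ball
    rw [dist_eq_norm, add_halves]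
    exact h c hc d hd hcd
  have hsub : (⋃ c ∈ s, Metric.ball (c : E) (η / 2)) ⊆ Metric.ball 0 (ρ + η / 2) := by
    refine Set.iUnion₂_subset fun x hx => Metric.ball_subset_ball' ?_
    rw [dist_zero_right, add_comm]
    exact add_le_add (hs x hx) le_rfl
  have I : (s.card : ℝ≥0∞) * ENNReal.ofReal ((η / 2) ^ Module.finrank ℝ E) * μ (Metric.ball 0 1) ≤
      ENNReal.ofReal ((ρ + η / 2) ^ Module.finrank ℝ E) * μ (Metric.ball 0 1) := by
    calc _ = μ (⋃ c ∈ s, Metric.ball (c : E) (η / 2)) := by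
          rw [measure_biUnion_finset D fun c _ => measurableSet_ball]
          simp only [μ.addHaar_ball_of_pos _ hδ, Finset.sum_const, nsmul_eq_mul, mul_assoc]
      _ ≤ μ (Metric.ball (0 : E) (ρ + η / 2)) := measure_mono hsub
      _ = _ := by rw [μ.addHaar_ball_of_pos _ hσ]
  have J := (ENNReal.mul_le_mul_iff_left (Metric.measure_ball_pos μ _ zero_lt_one).ne'
    measure_ball_lt_top.ne).1 I
  have K := ENNReal.toReal_le_of_le_ofReal (by positivity) J
  rw [ENNReal.toReal_mul, ENNReal.toReal_ofReal (by positivity), ENNReal.toReal_natCast] at K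
  have e : 1 + 2 * ρ / η = (ρ + η / 2) / (η / 2) := by field_simp; ring
  rwa [e, div_pow, le_div_iff₀ (by positivity)]

/-- A separated set of maximal cardinality is a net, since an uncovered point could be added to it.
-/
theorem exists_finset_cover_closedBall {E : Type*} [NormedAddCommGroup E] [NormedSpace ℝ E]
    [FiniteDimensional ℝ E] {ρ η : ℝ} (hρ : 0 ≤ ρ) (hη : 0 < η) :
    ∃ s : Finset E, (s.card : ℝ) ≤ (1 + 2 * ρ / η) ^ Module.finrank ℝ E ∧
      ∀ x : E, ‖x‖ ≤ ρ → ∃ c ∈ s, ‖x - c‖ ≤ η := by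
  classical
  let P : Finset E → Prop := fun s =>
    (∀ c ∈ s, ‖c‖ ≤ ρ) ∧ ∀ c ∈ s, ∀ d ∈ s, c ≠ d → η ≤ ‖c - d‖
  let A : Set ℕ := Finset.card '' {s | P s}
  have hbdd : BddAbove A := by
    refine ⟨⌊(1 + 2 * ρ / η) ^ Module.finrank ℝ E⌋₊, ?_⟩
    rintro _ ⟨s, hs, rfl⟩
    exact Nat.le_floor (card_mul_pow_le_of_separated hρ hη s hs.1 hs.2)
  have hne : A.Nonempty := ⟨0, ∅, by simp [P], rfl⟩
  obtain ⟨s, hs, hcard⟩ := Nat.sSup_mem hne hbdd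
  refine ⟨s, card_mul_pow_le_of_separated hρ hη s hs.1 hs.2, fun x hx => ?_⟩
  by_contra! hfar
  have hxs : x ∉ s := fun hmem => by simpa using (hfar x hmem).trans' hη
  have hP : P (insert x s) := by
    refine ⟨fun c hc => ?_, fun c hc d hd hcd => ?_⟩
    · rcases Finset.mem_insert.1 hc with rfl | hc
      exacts [hx, hs.1 c hc]
    · rcases Finset.mem_insert.1 hc with rfl | hc <;> rcases Finset.mem_insert.1 hd with rfl | hd
      · exact absurd rfl hcd
      · exact (hfar d hd).le
      · rw [norm_sub_rev]; exact (hfar c (Finset.mem_of_mem_insert_of_ne hc hcd)).le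
      · exact hs.2 c hc d hd hcd
  have := le_csSup hbdd ⟨insert x s, hP, rfl⟩
  rw [Finset.card_insert_of_notMem hxs, ← hcard] at this
  omega

/-! ### Nets of the unitary group -/

open scoped Matrix.Norms.L2Operator

open NormedSpace in
-- The path `t ↦ exp (i t a) exp (i (1 - t) b)` joins the two exponentials. Its velocity is `i (a -
-- b)` between two unitaries, so no commutation of `a` and `b` is needed.
theorem norm_exp_I_smul_sub_le {A : Type*} [CStarAlgebra A] (a b : selfAdjoint A) :
    ‖exp (Complex.I • (a : A)) - exp (Complex.I • (b : A))‖ ≤ ‖a - b‖ := by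
  nontriviality A
  let Fa : ℝ → A := fun t => exp (t • (Complex.I • (a : A)))
  let Fb : ℝ → A := fun t => exp ((1 - t) • (Complex.I • (b : A)))
  have hFa : ∀ t, HasDerivAt Fa (Fa t * (Complex.I • (a : A))) t := fun t =>
    hasDerivAt_exp_smul_const _ t
  have hFb : ∀ t, HasDerivAt Fb (-((Complex.I • (b : A)) * Fb t)) t := fun t => by
    have h := (hasDerivAt_exp_smul_const' (Complex.I • (b : A)) (1 - t)).scomp t
      ((hasDerivAt_id t).const_sub 1)
    simp only [neg_smul, one_smul] at h
    exact h
  have hnorm : ∀ (c : selfAdjoint A) (t : ℝ), ‖exp (t • (Complex.I • (c : A)))‖ = 1 := by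
    intro c t
    have : exp (t • (Complex.I • (c : A))) = (selfAdjoint.expUnitary (t • c) : A) := by
      rw [selfAdjoint.expUnitary_coe, smul_comm]; rfl
    rw [this]
    exact CStarRing.norm_coe_unitary _
  have hD : ∀ t ∈ Set.Icc (0 : ℝ) 1, HasDerivWithinAt (fun t => Fa t * Fb t)
      (Fa t * (Complex.I • ((a : A) - b)) * Fb t) (Set.Icc (0 : ℝ) 1) t := by
    intro t _
    refine (((hFa t).mul (hFb t)).congr_deriv ?_).hasDerivWithinAt
    rw [smul_sub, mul_sub, sub_mul]
    noncomm_ring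
  have := norm_image_sub_le_of_norm_deriv_le_segment_01' hD (C := ‖a - b‖) fun t _ => by
    calc _ ≤ ‖Fa t‖ * ‖Complex.I • ((a : A) - b)‖ * ‖Fb t‖ :=
          (norm_mul_le _ _).trans (mul_le_mul_of_nonneg_right (norm_mul_le _ _) (norm_nonneg _))
      _ = ‖a - b‖ := by
          rw [hnorm, hnorm, norm_smul]; simp
  simpa [Fa, Fb] using this

open NormedSpace in
-- On a finite spectrum the argument is continuous even across its branch cut, so the functional
-- calculus supplies a logarithm without a spectral gap at `-1`.
theorem Unitary.exists_selfAdjoint_exp_of_finite_spectrum {A : Type*} [CStarAlgebra A]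
    (u : unitary A) (hu : (spectrum ℂ (u : A)).Finite) :
    ∃ a : selfAdjoint A, ‖a‖ ≤ Real.pi ∧ exp (Complex.I • (a : A)) = u := by
  refine ⟨argSelfAdjoint u, norm_argSelfAdjoint_le_pi u, ?_⟩
  have : ContinuousOn Complex.arg (spectrum ℂ (u : A)) := hu.continuousOn _
  rw [argSelfAdjoint_coe, ← CFC.exp_eq_normedSpace_exp (𝕜 := ℂ),
    ← cfc_comp_smul .., ← cfc_comp' ..]
  conv_rhs => rw [← cfc_id' ℂ (u : A)]
  refine cfc_congr fun y hy ↦ ?_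
  have hy₁ : ‖y‖ = 1 := spectrum.norm_eq_one_of_unitary u.2 hy
  have h : Complex.I * y.arg = Complex.log y :=
    Complex.ext (by simp [Complex.log_re, hy₁]) (by simp [Complex.log_im])
  have hy0 : y ≠ 0 := by rintro rfl; simp at hy₁
  simpa [← Complex.exp_eq_exp_ℂ, h] using Complex.exp_log hy0

/-- The real linear map `H ↦ Re H + Im H`, which is injective on Hermitian matrices since `Re H` is
symmetric and `Im H` is antisymmetric. -/
noncomputable def reAddIm (ι : Type*) :
    selfAdjoint (Matrix ι ι ℂ) →ₗ[ℝ] (ι × ι → ℝ) where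
  toFun H p := (H.1 p.1 p.2).re + (H.1 p.1 p.2).im
  map_add' H G := by ext; simp; ring
  map_smul' c H := by ext; simp; ring

theorem reAddIm_injective (ι : Type*) : Function.Injective (reAddIm ι) := by
  intro H G h
  have hs : ∀ (H : selfAdjoint (Matrix ι ι ℂ)) i j,
      (H.1 j i).re = (H.1 i j).re ∧ (H.1 j i).im = -(H.1 i j).im := fun H i j => by
    have : star (H.1 i j) = H.1 j i := congrFun (congrFun H.2 j) i
    rw [← this]; simp
  ext i j
  have h1 := congrFun h (i, j)
  have h2 := congrFun h (j, i)
  simp only [reAddIm, LinearMap.coe_mk, AddHom.coe_mk] at h1 h2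
  rw [(hs H i j).1, (hs H i j).2, (hs G i j).1, (hs G i j).2] at h2
  exact Complex.ext (by linarith) (by linarith)

instance (ι : Type*) [Fintype ι] : FiniteDimensional ℝ (selfAdjoint (Matrix ι ι ℂ)) :=
  FiniteDimensional.of_injective (reAddIm ι) (reAddIm_injective ι)

theorem finrank_selfAdjoint_matrix_le (ι : Type*) [Fintype ι] :
    Module.finrank ℝ (selfAdjoint (Matrix ι ι ℂ)) ≤ Fintype.card ι ^ 2 := by
  have := LinearMap.finrank_le_finrank_of_injective (reAddIm_injective ι)
  rwa [Module.finrank_fintype_fun_eq_card, Fintype.card_prod, ← sq] at this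

theorem exists_finset_cover_unitaryGroup (ι : Type*) [Fintype ι] [DecidableEq ι] {r : ℝ}
    (hr : 0 < r) (hr' : r ≤ 28) :
    ∃ s : Finset (Matrix ι ι ℂ), (s.card : ℝ) ≤ (28 / r) ^ (Fintype.card ι ^ 2) ∧
      ∀ u ∈ Matrix.unitaryGroup ι ℂ, ∃ c ∈ s, ‖u - c‖ ≤ r := by
  classical
  have h1 : 1 ≤ 28 / r := (one_le_div hr).2 hr'
  rcases le_or_gt r 1 with hle | hlt
  · obtain ⟨s, hs, hcov⟩ :=
      exists_finset_cover_closedBall (E := selfAdjoint (Matrix ι ι ℂ)) Real.pi_pos.le hr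
    refine ⟨s.image fun a : selfAdjoint (Matrix ι ι ℂ) =>
      NormedSpace.exp (Complex.I • (a : Matrix ι ι ℂ)), ?_, ?_⟩
    -- For `r ≤ 1` this only needs `r + 2 π ≤ 28`. For larger `r` the single centre `0` already
    -- covers.
    · have hb : 1 + 2 * Real.pi / r ≤ 28 / r := by
        rw [← sub_nonneg]
        have : 28 / r - (1 + 2 * Real.pi / r) = (28 - 2 * Real.pi - r) / r := by field_simp; ring
        rw [this]
        have := Real.pi_le_four
        apply div_nonneg <;> linarith
      calc _ ≤ (s.card : ℝ) := by exact_mod_cast Finset.card_image_le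
        _ ≤ _ := hs
        _ ≤ (28 / r) ^ Module.finrank ℝ (selfAdjoint (Matrix ι ι ℂ)) :=
          pow_le_pow_left₀ (by positivity) hb _
        _ ≤ _ := pow_le_pow_right₀ h1 (finrank_selfAdjoint_matrix_le ι)
    · intro u hu
      obtain ⟨a, ha, hau⟩ := Unitary.exists_selfAdjoint_exp_of_finite_spectrum
        (⟨u, hu⟩ : unitary (Matrix ι ι ℂ)) (Matrix.finite_spectrum u)
      obtain ⟨c, hc, hac⟩ := hcov a ha
      refine ⟨_, Finset.mem_image_of_mem _ hc, ?_⟩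
      have hau' : NormedSpace.exp (Complex.I • (a : Matrix ι ι ℂ)) = u := hau
      rw [← hau']
      exact (norm_exp_I_smul_sub_le a c).trans hac
  · refine ⟨{0}, by simpa using one_le_pow₀ h1, fun u hu => ⟨0, by simp, ?_⟩⟩
    rw [sub_zero]
    rcases subsingleton_or_nontrivial (Matrix ι ι ℂ) with _ | _
    · rw [Subsingleton.elim u 0, norm_zero]; exact hr.le
    · rw [CStarRing.norm_of_mem_unitary hu]; exact hlt.le

/-- The exponent `d` is free so that gates on different numbers of qubits can share one label type.
-/
theorem exists_measurable_label_unitaryGroup {X ι : Type*} [MeasurableSpace X] [Fintype ι]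
    [DecidableEq ι] (u : X → Matrix.unitaryGroup ι ℂ)
    (hu : ∀ i j, Measurable fun x => (u x : Matrix ι ι ℂ) i j) {r : ℝ}
    (hr : 0 < r) (hr' : r ≤ 28) {d : ℕ} (hd : Fintype.card ι ^ 2 ≤ d) :
    ∃ p : X → Fin ⌊(28 / r) ^ d⌋₊, Measurable p ∧
      ∀ x x', p x = p x' → ‖(u x : Matrix ι ι ℂ) - u x'‖ ≤ 2 * r := by
  classical
  obtain ⟨s, hs, hcov⟩ := exists_finset_cover_unitaryGroup ι hr hr'
  have h1 : 1 ≤ 28 / r := (one_le_div hr).2 hr'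
  have hcard : s.card ≤ ⌊(28 / r) ^ d⌋₊ :=
    Nat.le_floor (hs.trans (pow_le_pow_right₀ h1 hd))
  let e := s.equivFin
  have hex : ∀ x, ∃ k : ℕ, ∃ h : k < s.card, ‖(u x : Matrix ι ι ℂ) - e.symm ⟨k, h⟩‖ ≤ r := by
    intro x
    obtain ⟨c, hc, hxc⟩ := hcov _ (u x).2
    exact ⟨e ⟨c, hc⟩, (e ⟨c, hc⟩).2, by simpa using hxc⟩
  -- Taking the least index of a nearby centre makes the choice measurable.
  let q : X → ℕ := fun x => Nat.find (hex x)
  have hq : Measurable q := by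
    refine measurable_find hex fun k => ?_
    by_cases h : k < s.card
    · simp only [h, exists_true_left]
      have hm : Measurable fun x => (fun i j => (u x : Matrix ι ι ℂ) i j : ι → ι → ℂ) :=
        measurable_pi_lambda _ fun i => measurable_pi_lambda _ fun j => hu i j
      have hc : Continuous fun M : ι → ι → ℂ =>
          ‖(Matrix.of M : Matrix ι ι ℂ) - e.symm ⟨k, h⟩‖ := by
        have : Continuous fun M : Matrix ι ι ℂ => ‖M - e.symm ⟨k, h⟩‖ := by fun_prop
        exact this
      exact measurableSet_le (hc.measurable.comp hm) measurable_const
    · simp [h]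
  have hlt : ∀ x, q x < s.card := fun x => (Nat.find_spec (hex x)).1
  refine ⟨fun x => ⟨q x, (hlt x).trans_le hcard⟩, ?_, fun x x' hxx' => ?_⟩
  · refine measurable_to_countable' fun k => ?_
    convert! hq (measurableSet_singleton (k : ℕ)) using 1
    ext x
    simp [Fin.ext_iff]
  · obtain ⟨h, hx⟩ := Nat.find_spec (hex x)
    obtain ⟨h', hx'⟩ := Nat.find_spec (hex x')
    have hqq : q x = q x' := by simpa using hxx'
    have heq : (e.symm ⟨Nat.find (hex x), h⟩ : Matrix ι ι ℂ)
        = e.symm ⟨Nat.find (hex x'), h'⟩ := by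
      congr 3
    rw [heq] at hx
    rw [norm_sub_rev] at hx'
    calc _ ≤ _ := norm_sub_le_norm_sub_add_norm_sub _ (e.symm ⟨Nat.find (hex x'), h'⟩ : Matrix ι ι ℂ) _
      _ ≤ 2 * r := by linarith

/-! ### Stability of the classifier under perturbation of the encoding -/

section Quantum

open scoped Matrix.Norms.L2Operator Kronecker

theorem onQubits_eq_submatrix_kronecker {N : ℕ} (S : Finset (Fin N))
    (A : Matrix (Qubits S) (Qubits S) ℂ) :
    onQubits S A = (A ⊗ₖ (1 : Matrix ({q // q ∉ S} → Fin 2) ({q // q ∉ S} → Fin 2) ℂ)).submatrix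
      (Equiv.piEquivPiSubtypeProd (· ∈ S) fun _ => Fin 2)
      (Equiv.piEquivPiSubtypeProd (· ∈ S) fun _ => Fin 2) := by
  ext i j
  simp only [onQubits, Matrix.submatrix_apply, Matrix.kronecker_apply, Matrix.one_apply,
    Equiv.piEquivPiSubtypeProd_apply, funext_iff, Subtype.forall, mul_ite, mul_one, mul_zero]

/-- Extending an operator by the identity on the other qubits, as a homomorphism of star
algebras. -/
noncomputable def onQubitsHom {N : ℕ} (S : Finset (Fin N)) :
    Matrix (Qubits S) (Qubits S) ℂ →⋆ₙₐ[ℂ] Matrix (Qubits (Fin N)) (Qubits (Fin N)) ℂ where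
  toFun := onQubits S
  map_smul' c A := by
    simp only [onQubits_eq_submatrix_kronecker, Matrix.smul_kronecker, Matrix.submatrix_smul]
    rfl
  map_zero' := by simp [onQubits_eq_submatrix_kronecker]
  map_add' A B := by
    simp only [onQubits_eq_submatrix_kronecker, Matrix.add_kronecker, Matrix.submatrix_add]
    rfl
  map_mul' A B := by
    simp only [onQubits_eq_submatrix_kronecker, Matrix.submatrix_mul_equiv,
      ← Matrix.mul_kronecker_mul, one_mul]
  map_star' A := by
    simp only [onQubits_eq_submatrix_kronecker, Matrix.star_eq_conjTranspose,
      Matrix.conjTranspose_submatrix, Matrix.conjTranspose_kronecker, Matrix.conjTranspose_one]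

/-- Star homomorphisms between C*-algebras are contractive. -/
theorem norm_onQubits_le {N : ℕ} (S : Finset (Fin N)) (A : Matrix (Qubits S) (Qubits S) ℂ) :
    ‖onQubits S A‖ ≤ ‖A‖ :=
  NonUnitalStarAlgHom.norm_apply_le (onQubitsHom S) A

theorem onQubits_sub {N : ℕ} (S : Finset (Fin N)) (A B : Matrix (Qubits S) (Qubits S) ℂ) :
    onQubits S (A - B) = onQubits S A - onQubits S B :=
  map_sub (onQubitsHom S) A B

theorem norm_coe_unitaryGroup_le {ι : Type*} [Fintype ι] [DecidableEq ι]
    (u : Matrix.unitaryGroup ι ℂ) : ‖(u : Matrix ι ι ℂ)‖ ≤ 1 := by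
  rcases subsingleton_or_nontrivial (Matrix ι ι ℂ) with _ | _
  · rw [Subsingleton.elim (u : Matrix ι ι ℂ) 0, norm_zero]; exact zero_le_one
  · exact (CStarRing.norm_of_mem_unitary u.2).le

theorem Matrix.norm_entry_le_l2_opNorm {ι : Type*} [Fintype ι] [DecidableEq ι]
    (A : Matrix ι ι ℂ) (i j : ι) : ‖A i j‖ ≤ ‖A‖ := by
  have h := (Matrix.toEuclideanCLM (n := ι) (𝕜 := ℂ) A).le_opNorm (EuclideanSpace.single j 1)
  rw [PiLp.norm_single, norm_one, mul_one, Matrix.l2_opNorm_toEuclideanCLM] at h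
  refine le_trans ?_ ((PiLp.norm_apply_le _ i).trans h)
  simp

theorem norm_prod_ofFn_le_one {A : Type*} [NormedRing A] [NormOneClass A] :
    ∀ {k : ℕ} (F : Fin k → A), (∀ g, ‖F g‖ ≤ 1) → ‖(List.ofFn F).prod‖ ≤ 1
  | 0, F, _ => by simp
  | k + 1, F, h => by
    rw [List.ofFn_succ, List.prod_cons]
    exact (norm_mul_le _ _).trans (mul_le_one₀ (h 0) (norm_nonneg _)
      (norm_prod_ofFn_le_one _ fun g => h g.succ))

/-- Telescoping: factors are exchanged one at a time, all others being contractions. -/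
theorem norm_prod_ofFn_sub_le {A : Type*} [NormedRing A] [NormOneClass A] :
    ∀ {k : ℕ} (F G : Fin k → A), (∀ g, ‖F g‖ ≤ 1) → (∀ g, ‖G g‖ ≤ 1) →
      ‖(List.ofFn F).prod - (List.ofFn G).prod‖ ≤ ∑ g, ‖F g - G g‖
  | 0, F, G, _, _ => by simp
  | k + 1, F, G, hF, hG => by
    rw [List.ofFn_succ, List.ofFn_succ, List.prod_cons, List.prod_cons, Fin.sum_univ_succ]
    set P := (List.ofFn fun g => F (Fin.succ g)).prod
    set P' := (List.ofFn fun g => G (Fin.succ g)).prod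
    have hP : ‖P‖ ≤ 1 := norm_prod_ofFn_le_one _ fun g => hF g.succ
    have ih : ‖P - P'‖ ≤ _ :=
      norm_prod_ofFn_sub_le (fun g => F (Fin.succ g)) (fun g => G (Fin.succ g))
        (fun g => hF g.succ) fun g => hG g.succ
    have e : F 0 * P - G 0 * P' = (F 0 - G 0) * P + G 0 * (P - P') := by noncomm_ring
    rw [e]
    refine (norm_add_le _ _).trans (add_le_add ?_ ?_)
    · exact (norm_mul_le _ _).trans (mul_le_of_le_one_right (norm_nonneg _) hP)
    · exact (norm_mul_le _ _).trans ((mul_le_of_le_one_left (norm_nonneg _) (hG 0)).trans ih)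

/-- With `W = V U` and `W' = V U'`, one copy is exchanged at a time, which gives the factor 2; the
contraction `V` drops out, and with it the ansatz. -/
theorem norm_star_mul_mul_sub_le {A : Type*} [CStarAlgebra A] (O : A) {V U U' : A}
    (hV : ‖V‖ ≤ 1) (hU : ‖U‖ ≤ 1) (hU' : ‖U'‖ ≤ 1) :
    ‖star (V * U) * O * (V * U) - star (V * U') * O * (V * U')‖ ≤ 2 * ‖O‖ * ‖U - U'‖ := by
  have hW : ‖V * U‖ ≤ 1 := (norm_mul_le _ _).trans (mul_le_one₀ hV (norm_nonneg _) hU)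
  have hW' : ‖V * U'‖ ≤ 1 := (norm_mul_le _ _).trans (mul_le_one₀ hV (norm_nonneg _) hU')
  have hd : ‖V * U - V * U'‖ ≤ ‖U - U'‖ := by
    rw [← mul_sub]
    exact (norm_mul_le _ _).trans (mul_le_of_le_one_left (norm_nonneg _) hV)
  generalize V * U = W at *
  generalize V * U' = W' at *
  have e : star W * O * W - star W' * O * W' =
      star (W - W') * O * W + star W' * O * (W - W') := by
    rw [star_sub]; noncomm_ring
  have hb : ∀ a b c : A, ‖a * b * c‖ ≤ ‖a‖ * ‖b‖ * ‖c‖ := fun a b c => (norm_mul_le _ _).trans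
    (mul_le_mul_of_nonneg_right (norm_mul_le _ _) (norm_nonneg _))
  calc _ ≤ ‖W - W'‖ * ‖O‖ * ‖W‖ + ‖W'‖ * ‖O‖ * ‖W - W'‖ := by
        rw [e]
        refine (norm_add_le _ _).trans (add_le_add ((hb _ _ _).trans_eq ?_)
          ((hb _ _ _).trans_eq ?_)) <;> rw [norm_star]
    _ ≤ ‖W - W'‖ * ‖O‖ * 1 + 1 * ‖O‖ * ‖W - W'‖ := by gcongr
    _ = 2 * ‖O‖ * ‖W - W'‖ := by ring
    _ ≤ _ := by gcongr

variable {X : Type*} [MeasurableSpace X] {Θ : Type*} {N m K : ℕ}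

namespace EncodingCircuit

theorem norm_onQubits_gate_le (E : EncodingCircuit X N m) (x : X) (g : Fin E.numGates) :
    ‖onQubits (E.support g) (E.gate g x).1‖ ≤ 1 :=
  (norm_onQubits_le _ _).trans (norm_coe_unitaryGroup_le _)

theorem norm_unitary_le (E : EncodingCircuit X N m) (x : X) : ‖E.unitary x‖ ≤ 1 :=
  norm_prod_ofFn_le_one _ (E.norm_onQubits_gate_le x)

theorem norm_unitary_sub_le (E : EncodingCircuit X N m) {x x' : X} {η : ℝ}
    (h : ∀ g ∈ E.variational, ‖(E.gate g x).1 - (E.gate g x').1‖ ≤ η) :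
    ‖E.unitary x - E.unitary x'‖ ≤ E.numVariational * η := by
  classical
  refine (norm_prod_ofFn_sub_le _ _ (E.norm_onQubits_gate_le x)
    (E.norm_onQubits_gate_le x')).trans ?_
  calc _ = ∑ g ∈ E.variational, ‖onQubits (E.support g) (E.gate g x).1
            - onQubits (E.support g) (E.gate g x').1‖ := by
        refine (Finset.sum_subset (Finset.subset_univ _) fun g _ hg => ?_).symm
        rw [E.fixed g hg x x', sub_self, norm_zero]
    _ ≤ ∑ g ∈ E.variational, η := Finset.sum_le_sum fun g hg => by
        rw [← onQubits_sub]
        exact (norm_onQubits_le _ _).trans (h g hg)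
    _ = _ := by simp [numVariational]

theorem exists_measurable_label (E : EncodingCircuit X N m) {r : ℝ} (hr : 0 < r) (hr' : r ≤ 28) :
    ∃ p : X → (E.variational → Fin ⌊(28 / r) ^ 4 ^ m⌋₊), Measurable p ∧
      ∀ x x', p x = p x' → ‖E.unitary x - E.unitary x'‖ ≤ E.numVariational * (2 * r) := by
  have hd : ∀ g, Fintype.card (Qubits (E.support g)) ^ 2 ≤ 4 ^ m := fun g => by
    rw [Fintype.card_fun, Fintype.card_fin, Fintype.card_coe, ← pow_mul, mul_comm, pow_mul]
    exact Nat.pow_le_pow_right (by norm_num) (E.card_support_le g)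
  choose p hp hp' using fun g => exists_measurable_label_unitaryGroup (E.gate g)
    (E.measurable_gate g) hr hr' (hd g)
  refine ⟨fun x g => p g x, measurable_pi_lambda _ fun g => hp g, fun x x' h => ?_⟩
  exact E.norm_unitary_sub_le fun g hg => hp' g x x' (congrFun h ⟨g, hg⟩)

theorem measurable_unitary (E : EncodingCircuit X N m) (i j : Qubits (Fin N)) :
    Measurable fun x => E.unitary x i j := by
  have key : ∀ {k : ℕ} (F : Fin k → X → Matrix (Qubits (Fin N)) (Qubits (Fin N)) ℂ),
      (∀ g i j, Measurable fun x => F g x i j) →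
      ∀ i j, Measurable fun x => (List.ofFn fun g => F g x).prod i j := by
    intro k
    induction k with
    | zero => intro F _ i j; simp
    | succ k ih =>
      intro F hF i j
      simp only [List.ofFn_succ, List.prod_cons, Matrix.mul_apply]
      exact Finset.measurable_sum _ fun l _ =>
        (hF 0 i l).mul (ih (fun g => F g.succ) (fun g => hF g.succ) l j)
  refine key (fun g x => onQubits (E.support g) (E.gate g x).1) (fun g i j => ?_) i j
  simp only [onQubits]
  split_ifs
  exacts [E.measurable_gate g _ _, measurable_const]

end EncodingCircuit

namespace QuantumClassifier

/-- Since the initial state is a rank-one projector, the trace collapses to one entry of the evolved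
observable. An entry is bounded by the operator norm, with no dimension factor. -/
theorem predict_apply (Q : QuantumClassifier X Θ N m K) (θ : Θ) (x : X) (k : Fin K) :
    Q.predict θ x k = ((((Q.ansatz θ).1 * Q.encoding.unitary x).conjTranspose *
      onQubits Q.measured (Q.observable θ k) *
        ((Q.ansatz θ).1 * Q.encoding.unitary x)) 0 0).re := by
  have h : ∀ (O V U : Matrix (Qubits (Fin N)) (Qubits (Fin N)) ℂ),
      Matrix.trace (O * (V * (U * Matrix.single 0 0 1 * U.conjTranspose) * V.conjTranspose)) =
        ((V * U).conjTranspose * O * (V * U)) 0 0 := by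
    intro O V U
    have e : O * (V * (U * Matrix.single 0 0 1 * U.conjTranspose) * V.conjTranspose) =
        (O * (V * U) * Matrix.single 0 0 1) * (V * U).conjTranspose := by
      rw [Matrix.conjTranspose_mul]; simp only [mul_assoc]
    rw [e, Matrix.trace_mul_comm, ← mul_assoc, ← mul_assoc, Matrix.trace_mul_single]
    simp
  exact congrArg Complex.re (h _ _ _)

theorem abs_predict_apply_sub_le (Q : QuantumClassifier X Θ N m K) (θ : Θ) (x x' : X)
    (k : Fin K) :
    |Q.predict θ x k - Q.predict θ x' k| ≤ 2 * matrixOpNorm (Q.observable θ k) *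
      ‖Q.encoding.unitary x - Q.encoding.unitary x'‖ := by
  have hO : ‖onQubits Q.measured (Q.observable θ k)‖ ≤ matrixOpNorm (Q.observable θ k) :=
    norm_onQubits_le _ _
  rw [predict_apply, predict_apply, ← Complex.sub_re, ← Matrix.sub_apply]
  refine (Complex.abs_re_le_norm _).trans ((Matrix.norm_entry_le_l2_opNorm _ _ _).trans ?_)
  refine (norm_star_mul_mul_sub_le _ (norm_coe_unitaryGroup_le (Q.ansatz θ))
    (Q.encoding.norm_unitary_le x) (Q.encoding.norm_unitary_le x')).trans ?_
  exact mul_le_mul_of_nonneg_right (mul_le_mul_of_nonneg_left hO two_pos.le) (norm_nonneg _)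

theorem dist_predict_le (Q : QuantumClassifier X Θ N m K) {θ : Θ} {C η : ℝ} (hC : 0 ≤ C)
    (hQ : ∀ k, matrixOpNorm (Q.observable θ k) ≤ C) {x x' : X}
    (h : ‖Q.encoding.unitary x - Q.encoding.unitary x'‖ ≤ η) :
    dist (Q.predict θ x) (Q.predict θ x') ≤ K * (2 * C * η) := by
  have hη : 0 ≤ η := (norm_nonneg _).trans h
  rw [EuclideanSpace.dist_eq]
  refine Real.sqrt_le_iff.2 ⟨by positivity, ?_⟩
  calc _ ≤ ∑ _k : Fin K, (2 * C * η) ^ 2 := Finset.sum_le_sum fun k _ => by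
        refine pow_le_pow_left₀ dist_nonneg ?_ 2
        rw [Real.dist_eq]
        refine (Q.abs_predict_apply_sub_le θ x x' k).trans ?_
        have := hQ k
        gcongr
    _ = K * (2 * C * η) ^ 2 := by simp
    -- The Euclidean norm only costs `√K`; it is relaxed to `K`.
    _ ≤ K ^ 2 * (2 * C * η) ^ 2 := by
        gcongr
        exact_mod_cast Nat.le_self_pow two_ne_zero K
    _ = _ := by ring

theorem measurable_predict (Q : QuantumClassifier X Θ N m K) (θ : Θ) :
    Measurable (Q.predict θ) := by
  refine (WithLp.measurable_toLp 2 _).comp (measurable_pi_lambda _ fun k => ?_)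
  change Measurable fun x => Q.predict θ x k
  simp only [predict_apply, Matrix.mul_apply, Matrix.conjTranspose_apply]
  refine Complex.measurable_re.comp ?_
  have := Q.encoding.measurable_unitary
  have hs : ∀ i j, Measurable fun x => star (∑ l, (Q.ansatz θ).1 i l * Q.encoding.unitary x l j) :=
    fun i j => continuous_star.measurable.comp
      (Finset.measurable_sum _ fun l _ => (this l j).const_mul _)
  exact Finset.measurable_sum _ fun i _ => (Finset.measurable_sum _ fun j _ =>
    (hs j 0).mul_const _).mul (Finset.measurable_sum _ fun l _ => (this l 0).const_mul _)

variable (Q : QuantumClassifier X Θ N m K) {ℓ : EuclideanSpace ℝ (Fin K) → Fin K → ℝ} {L : ℝ≥0}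
  {θ : Θ}

theorem abs_loss_sub_le {C η : ℝ} (hC : 0 ≤ C)
    (hL : ∀ y, LipschitzOnWith L (fun a => ℓ a y) (Set.range (Q.predict θ)))
    (hQ : ∀ k, matrixOpNorm (Q.observable θ k) ≤ C) {x x' : X} (y : Fin K)
    (h : ‖Q.encoding.unitary x - Q.encoding.unitary x'‖ ≤ η) :
    |Q.loss ℓ θ (x, y) - Q.loss ℓ θ (x', y)| ≤ L * (K * (2 * C * η)) := by
  rw [← Real.dist_eq]
  exact ((hL y).dist_le_mul _ ⟨x, rfl⟩ _ ⟨x', rfl⟩).trans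
    (mul_le_mul_of_nonneg_left (Q.dist_predict_le hC hQ h) L.2)

theorem measurable_loss
    (hL : ∀ y, LipschitzOnWith L (fun a => ℓ a y) (Set.range (Q.predict θ))) :
    Measurable (Q.loss ℓ θ) := by
  refine measurable_from_prod_countable_left fun y => ?_
  have hc : Continuous fun a : Set.range (Q.predict θ) => ℓ a y :=
    continuousOn_iff_continuous_domRestrict.1 (hL y).continuousOn
  exact hc.measurable.comp ((Q.measurable_predict θ).subtype_mk (h := fun x => ⟨x, rfl⟩))

/-- Boundedness makes `maxLoss` a genuine supremum rather than a default value. It holds because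
encoding unitaries are at distance at most 2 from each other and there are finitely many classes. -/
theorem bddAbove_range_loss (hℓ : ∀ a y, 0 ≤ ℓ a y)
    (hL : ∀ y, LipschitzOnWith L (fun a => ℓ a y) (Set.range (Q.predict θ)))
    {C : ℝ} (hQ : ∀ k, matrixOpNorm (Q.observable θ k) ≤ C) :
    BddAbove (Set.range (Q.loss ℓ θ)) := by
  rcases isEmpty_or_nonempty X with _ | ⟨⟨x₀⟩⟩
  · rw [Set.range_eq_empty]; exact bddAbove_empty
  refine ⟨∑ y, Q.loss ℓ θ (x₀, y) + L * (K * (2 * C * 2)), ?_⟩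
  rintro _ ⟨⟨x, y⟩, rfl⟩
  have hC : 0 ≤ C := (norm_nonneg _).trans (hQ y)
  have h2 : ‖Q.encoding.unitary x - Q.encoding.unitary x₀‖ ≤ 2 := by
    refine (norm_sub_le _ _).trans ?_
    linarith [Q.encoding.norm_unitary_le x, Q.encoding.norm_unitary_le x₀]
  have h := (abs_le.1 (Q.abs_loss_sub_le hC hL hQ y h2)).2
  have hs : Q.loss ℓ θ (x₀, y) ≤ ∑ y, Q.loss ℓ θ (x₀, y) :=
    Finset.single_le_sum (f := fun y => Q.loss ℓ θ (x₀, y)) (fun y _ => hℓ _ _) (Finset.mem_univ y)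
  linarith

theorem isRobust {n R : ℕ} (𝒜 : (Fin n → X × Fin K) → Θ)
    (hL : ∀ θ y, LipschitzOnWith L (fun a => ℓ a y) (Set.range (Q.predict θ)))
    {C ε : ℝ} (hQ : ∀ θ k, matrixOpNorm (Q.observable θ k) ≤ C)
    (hV : 1 ≤ Q.encoding.numVariational) (hε : 0 < ε) (hε' : ε ≤ 28 * Q.encoding.numVariational)
    (hR : R = ⌊(K : ℝ) * (28 * Q.encoding.numVariational / ε) ^
      (4 ^ m * Q.encoding.numVariational)⌋₊) :
    IsRobust R (fun D => Q.loss ℓ (𝒜 D)) (fun _ => 4 * L * K * C * ε) := by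
  classical
  set V := Q.encoding.numVariational with hVdef
  have hV0 : (0 : ℝ) < V := by exact_mod_cast hV
  -- With radius `ε / V`, equal labels put the encoding unitaries within `V * (2 * ε / V) = 2 * ε`;
  -- the Heisenberg factor 2 turns this into the 4 of the claim.
  obtain ⟨p, hpm, hp⟩ := Q.encoding.exists_measurable_label (r := ε / V) (by positivity)
    (by rwa [div_le_iff₀ hV0])
  have hquot : 28 / (ε / V) = 28 * V / ε := by field_simp
  have hcard : Fintype.card ((Q.encoding.variational → Fin ⌊(28 / (ε / V)) ^ 4 ^ m⌋₊) × Fin K) ≤ Fintype.card (Fin R) := by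
    rw [Fintype.card_fin, hR]
    refine Nat.le_floor ?_
    rw [Fintype.card_prod, Fintype.card_fun, Fintype.card_fin, Fintype.card_fin, Fintype.card_coe,
      mul_comm]
    push_cast
    rw [pow_mul, ← hquot]
    have : (⌊(28 / (ε / V)) ^ 4 ^ m⌋₊ : ℝ) ≤ (28 / (ε / V)) ^ 4 ^ m := Nat.floor_le (by positivity)
    exact mul_le_mul_of_nonneg_left (pow_le_pow_left₀ (by positivity) this _) (by positivity)
  -- There may be fewer labels than `R`; indices outside the range of `e` give empty cells.
  obtain ⟨e⟩ := Function.Embedding.nonempty_of_card_le hcard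
  let f : X × Fin K → Fin R := fun z => e (p z.1, z.2)
  have hf : Measurable f := by
    have he : Measurable e := measurable_of_countable _
    exact he.comp ((hpm.comp measurable_fst).prodMk measurable_snd)
  refine ⟨fun r => f ⁻¹' {r}, fun r => hf (measurableSet_singleton r), ?_, ?_, ?_⟩
  · intro r s hrs
    exact Disjoint.preimage f (by simpa using hrs)
  · ext z; simp
  · intro D i z r hi hz
    have heq : f (D i) = f z := (Set.mem_singleton_iff.1 hi).trans (Set.mem_singleton_iff.1 hz).symm
    have h := e.injective heq
    rw [Prod.mk.injEq] at h
    obtain ⟨x, y⟩ := z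
    obtain ⟨⟨x', y'⟩, hD⟩ : ∃ w, D i = w := ⟨_, rfl⟩
    rw [hD] at h ⊢
    obtain ⟨h1, rfl⟩ := h
    have hC : 0 ≤ C := (norm_nonneg _).trans (hQ (𝒜 D) y')
    refine (Q.abs_loss_sub_le hC (hL _) (hQ _) y' (hp _ _ h1)).trans_eq ?_
    rw [← hVdef]
    field_simp
    ring

end QuantumClassifier

end Quantum

/-! ### Concentration of cell frequencies and the robust generalization bound -/

section Concentration

theorem Real.add_sq_div_two_le_neg_log_one_sub {v : ℝ} (h0 : 0 ≤ v) (h1 : v < 1) :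
    v + v ^ 2 / 2 ≤ -Real.log (1 - v) := by
  have h := Real.hasSum_pow_div_log_of_abs_lt_one (x := v) (by rwa [abs_of_nonneg h0])
  have := sum_le_hasSum (Finset.range 2) (fun i _ => by positivity) h
  simpa [Finset.sum_range_succ, one_add_one_eq_two] using this

variable {Z : Type*} {n R : ℕ}

theorem natCast_ncard_eq_sum_indicator (A : Set Z) (D : Fin n → Z) :
    (({i | D i ∈ A} : Set (Fin n)).ncard : ℝ) = ∑ i, A.indicator 1 (D i) := by
  classical
  rw [Set.ncard_eq_toFinset_card']
  simp [Set.indicator_apply]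

theorem exists_cell_index {C : Fin R → Set Z} (hdisj : Pairwise fun r s => Disjoint (C r) (C s))
    (hcov : ⋃ r, C r = Set.univ) : ∃ c : Z → Fin R, ∀ z r, z ∈ C r ↔ c z = r := by
  have h : ∀ z, ∃ r, z ∈ C r := fun z => Set.mem_iUnion.1 (hcov ▸ Set.mem_univ z)
  choose c hc using h
  refine ⟨c, fun z r => ⟨fun hz => ?_, fun hz => hz ▸ hc z⟩⟩
  by_contra hne
  exact Set.disjoint_left.1 (hdisj hne) (hc z) hz

theorem sum_ncard_cellIndices_mul {C : Fin R → Set Z} (D : Fin n → Z) (a : Fin R → ℝ) {c : Z → Fin R} (hc : ∀ z r, z ∈ C r ↔ c z = r) :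
    ∑ r, ((cellIndices C D r).ncard : ℝ) * a r = ∑ i, a (c (D i)) := by
  have h : ∀ r, ((cellIndices C D r).ncard : ℝ) * a r = ∑ i, if c (D i) = r then a r else 0 := by
    intro r
    rw [cellIndices, natCast_ncard_eq_sum_indicator, Finset.sum_mul]
    refine Finset.sum_congr rfl fun i _ => ?_
    by_cases hi : c (D i) = r
    · rw [Set.indicator_of_mem ((hc _ _).2 hi), if_pos hi]; simp
    · rw [Set.indicator_of_notMem (fun h => hi ((hc _ _).1 h)), if_neg hi, zero_mul]
  simp_rw [h]
  rw [Finset.sum_comm]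
  simp

theorem sum_ncard_cellIndices {C : Fin R → Set Z}
    (hdisj : Pairwise fun r s => Disjoint (C r) (C s)) (hcov : ⋃ r, C r = Set.univ)
    (D : Fin n → Z) : ∑ r, ((cellIndices C D r).ncard : ℝ) = n := by
  obtain ⟨c, hc⟩ := exists_cell_index hdisj hcov
  simpa using sum_ncard_cellIndices_mul D 1 hc

/-- Unoccupied cells contribute nothing because `p r ≥ 0`. On the occupied ones Cauchy-Schwarz
applies, the frequencies having sum at most one. -/
theorem sum_max_frequency_sub_le (hn : 0 < n) {C : Fin R → Set Z}
    (hdisj : Pairwise fun r s => Disjoint (C r) (C s)) (hcov : ⋃ r, C r = Set.univ)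
    {D : Fin n → Z} {p : Fin R → ℝ} (hp : ∀ r, 0 ≤ p r) {L : ℝ} (hL : 0 ≤ L)
    (h : ∀ r, ((cellIndices C D r).ncard : ℝ) / n ≤
      p r + √(2 * (((cellIndices C D r).ncard : ℝ) / n) * L / n)) :
    ∑ r, max (((cellIndices C D r).ncard : ℝ) / n - p r) 0 ≤
      √(2 * (occupiedCells C D).ncard * L / n) := by
  classical
  have hn' : (0 : ℝ) < n := by exact_mod_cast hn
  set T : Finset (Fin R) := (occupiedCells C D).toFinset with hT
  have hTcard : (occupiedCells C D).ncard = T.card := Set.ncard_eq_toFinset_card' _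
  calc _ = ∑ r ∈ T, max (((cellIndices C D r).ncard : ℝ) / n - p r) 0 := by
        refine (Finset.sum_subset (Finset.subset_univ _) fun r _ hr => ?_).symm
        have h0 : (cellIndices C D r).ncard = 0 := by
          rw [hT, Set.mem_toFinset] at hr
          exact Nat.lt_one_iff.1 (not_le.1 hr)
        rw [h0]
        simpa using hp r
    _ ≤ ∑ r ∈ T, √(2 * L / n) * √(((cellIndices C D r).ncard : ℝ) / n) := by
        refine Finset.sum_le_sum fun r _ => ?_
        rw [← Real.sqrt_mul (by positivity)]
        have e : 2 * L / n * (((cellIndices C D r).ncard : ℝ) / n) =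
          2 * (((cellIndices C D r).ncard : ℝ) / n) * L / n := by ring
        rw [e]
        exact max_le (by linarith [h r]) (Real.sqrt_nonneg _)
    _ ≤ √(∑ _r ∈ T, 2 * L / n) * √(∑ r ∈ T, ((cellIndices C D r).ncard : ℝ) / n) :=
        Real.sum_sqrt_mul_sqrt_le _ (fun _ => by positivity) fun _ => by positivity
    _ ≤ √(∑ _r ∈ T, 2 * L / n) * 1 := by
        gcongr
        rw [Real.sqrt_le_one]
        calc _ ≤ ∑ r, ((cellIndices C D r).ncard : ℝ) / n :=
              Finset.sum_le_univ_sum_of_nonneg fun _ => by positivity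
          _ = 1 := by rw [← Finset.sum_div, sum_ncard_cellIndices hdisj hcov, div_self hn'.ne']
    _ = _ := by
        rw [mul_one, Finset.sum_const, nsmul_eq_mul, hTcard]
        congr 1
        ring

variable [MeasurableSpace Z]

open ProbabilityTheory in
-- Independence factors the exponential moment, and `1 + x ≤ exp x` bounds each factor by its
-- Poisson counterpart.
theorem mgf_sum_indicator_pi_le (μ : Measure Z) [IsProbabilityMeasure μ] {A : Set Z}
    (hA : MeasurableSet A) (t : ℝ) :
    mgf (fun D : Fin n → Z => ∑ i, A.indicator (1 : Z → ℝ) (D i)) (Measure.pi fun _ => μ) t ≤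
      Real.exp (n * (μ.real A * (Real.exp t - 1))) := by
  have h1 : ∫ z, Real.exp (t * A.indicator (1 : Z → ℝ) z) ∂μ = μ.real A * (Real.exp t - 1) + 1 := by
    have : ∀ z, Real.exp (t * A.indicator (1 : Z → ℝ) z) =
        A.indicator (fun _ => Real.exp t - 1) z + 1 := fun z => by
      by_cases h : z ∈ A <;> simp [h]
    simp_rw [this]
    rw [integral_add ((integrable_const _).indicator hA) (integrable_const _),
      integral_indicator_const _ hA]
    simp
  simp only [mgf, Finset.mul_sum, Real.exp_sum]
  rw [integral_fintype_prod_eq_pow (fun z => Real.exp (t * A.indicator (1 : Z → ℝ) z)), h1,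
    Fintype.card_fin, Real.exp_nat_mul]
  refine pow_le_pow_left₀ ?_ (Real.add_one_le_exp _) n
  rw [← h1]
  exact integral_nonneg fun z => (Real.exp_pos _).le

open ProbabilityTheory in
theorem measure_pi_ncard_ge_le (μ : Measure Z) [IsProbabilityMeasure μ] {A : Set Z}
    (hA : MeasurableSet A) {q : ℝ} (hq : 0 < q) (hpq : μ.real A ≤ q) :
    (Measure.pi fun _ : Fin n => μ) {D | n * q ≤ (({i | D i ∈ A} : Set (Fin n)).ncard : ℝ)} ≤
      ENNReal.ofReal (Real.exp (-(n * ((q - μ.real A) ^ 2 / (2 * q))))) := by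
  set p := μ.real A
  have hp : 0 ≤ p := measureReal_nonneg
  set v := 1 - p / q with hv
  have hv0 : 0 ≤ v := sub_nonneg.2 ((div_le_one hq).2 hpq)
  -- The optimal Chernoff parameter is `log (q / p) = -log (1 - v)`. Its second-order truncation
  -- also makes sense for `p = 0`, keeps `p * exp t ≤ q`, and gives the exponent `q - p - t * q =
  -- -(q - p) ^ 2 / (2 * q)`.
  set t := v + v ^ 2 / 2 with ht
  have ht0 : 0 ≤ t := by positivity
  have hpt : p * Real.exp t ≤ q := by
    rcases hp.eq_or_lt with h | h
    · rw [← h, zero_mul]; exact hq.le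
    · have hv1 : v < 1 := by have := div_pos h hq; linarith
      have : Real.exp t ≤ q / p := by
        rw [← Real.le_log_iff_exp_le (by positivity)]
        refine (Real.add_sq_div_two_le_neg_log_one_sub hv0 hv1).trans_eq ?_
        rw [hv, sub_sub_cancel, ← Real.log_inv, inv_div]
      calc p * Real.exp t ≤ p * (q / p) := by gcongr
        _ = q := by field_simp
  have hX : Measurable fun D : Fin n → Z => ∑ i, A.indicator (1 : Z → ℝ) (D i) :=
    Finset.measurable_sum _ fun i _ => (measurable_one.indicator hA).comp (measurable_pi_apply i)
  have hint : Integrable (fun D : Fin n → Z =>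
      Real.exp (t * ∑ i, A.indicator (1 : Z → ℝ) (D i))) (Measure.pi fun _ => μ) := by
    refine Integrable.of_bound ((hX.const_mul t).exp).aestronglyMeasurable (Real.exp (t * n))
      (.of_forall fun D => ?_)
    rw [Real.norm_eq_abs, Real.abs_exp, Real.exp_le_exp, ← natCast_ncard_eq_sum_indicator]
    gcongr
    simpa using Set.ncard_le_card ({i | D i ∈ A} : Set (Fin n))
  have hcher := measure_ge_le_exp_mul_mgf (μ := Measure.pi fun _ : Fin n => μ) (n * q) ht0 hint
  simp_rw [natCast_ncard_eq_sum_indicator]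
  rw [← ENNReal.ofReal_toReal (measure_ne_top (Measure.pi fun _ : Fin n => μ) _)]
  refine ENNReal.ofReal_le_ofReal (hcher.trans ?_)
  calc _ ≤ Real.exp (-t * (n * q)) * Real.exp (n * (p * (Real.exp t - 1))) := by
        gcongr
        exact mgf_sum_indicator_pi_le μ hA t
    _ = Real.exp (n * (p * Real.exp t - p - t * q)) := by rw [← Real.exp_add]; congr 1; ring
    _ ≤ Real.exp (n * (q - p - t * q)) := by gcongr
    _ = _ := by
        congr 1
        rw [ht, hv]
        field_simp
        ring

/-- Chernoff's upper tail bound for the empirical frequency of an event, with a data-dependent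
deviation. -/
theorem measure_pi_lt_frequency_le (hn : 0 < n) (μ : Measure Z) [IsProbabilityMeasure μ]
    {A : Set Z} (hA : MeasurableSet A) (L : ℝ) :
    (Measure.pi fun _ : Fin n => μ) {D | μ.real A +
        √(2 * ((({i | D i ∈ A} : Set (Fin n)).ncard : ℝ) / n) * L / n) <
          (({i | D i ∈ A} : Set (Fin n)).ncard : ℝ) / n} ≤ ENNReal.ofReal (Real.exp (-L)) := by
  set E : Set (Fin n → Z) := {D | μ.real A +
        √(2 * ((({i | D i ∈ A} : Set (Fin n)).ncard : ℝ) / n) * L / n) <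
          (({i | D i ∈ A} : Set (Fin n)).ncard : ℝ) / n}
  have hn' : (0 : ℝ) < n := by exact_mod_cast hn
  rcases E.eq_empty_or_nonempty with h | hne
  · rw [h, measure_empty]; exact zero_le
  -- A sample of least count in the event fixes a threshold `q`. The event with random deviation
  -- then lies in the tail beyond the deterministic level `n * q`.
  obtain ⟨D₀, hD₀, hmin⟩ := WellFounded.has_min
    (measure fun D : Fin n → Z => ({i | D i ∈ A} : Set (Fin n)).ncard).wf E hne
  set q : ℝ := (({i | D₀ i ∈ A} : Set (Fin n)).ncard : ℝ) / n with hq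
  have hlt : μ.real A + √(2 * q * L / n) < q := hD₀
  have hp : 0 ≤ μ.real A := measureReal_nonneg
  have hs := Real.sqrt_nonneg (2 * q * L / n)
  have hq0 : 0 < q := by linarith
  refine (measure_mono fun D hD => ?_).trans
    ((measure_pi_ncard_ge_le μ hA hq0 (by linarith)).trans
      (ENNReal.ofReal_le_ofReal (Real.exp_le_exp.2 (neg_le_neg ?_))))
  · have : ({i | D₀ i ∈ A} : Set (Fin n)).ncard ≤ ({i | D i ∈ A} : Set (Fin n)).ncard :=
      not_lt.1 (hmin D hD)
    rw [Set.mem_ofPred_eq, hq, mul_div_cancel₀ _ hn'.ne']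
    exact_mod_cast this
  · have h2 : 2 * q * L / n < (q - μ.real A) ^ 2 := (Real.sqrt_lt' (by linarith)).1 (by linarith)
    rw [div_lt_iff₀ hn'] at h2
    rw [← mul_div_assoc, le_div_iff₀ (by positivity)]
    linarith

/-- With `a r` the mean loss on the cell `C r`, the risk is `∑ p r * a r`, while robustness puts `∑
w r * a r` within `ν` above the empirical risk. What remains is `∑ (p r - w r) * a r` with `0 ≤ a r
≤ ξ`. -/
theorem generalizationError_le_of_partition (hn : 0 < n) (μ : Measure Z) [IsProbabilityMeasure μ]
    {C : Fin R → Set Z} (hmeas : ∀ r, MeasurableSet (C r))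
    (hdisj : Pairwise fun r s => Disjoint (C r) (C s)) (hcov : ⋃ r, C r = Set.univ)
    {f : Z → ℝ} (hf : Measurable f) {ξ ν : ℝ} (h0 : ∀ z, 0 ≤ f z) (hξ : ∀ z, f z ≤ ξ)
    {D : Fin n → Z} (hrob : ∀ i z r, D i ∈ C r → z ∈ C r → |f (D i) - f z| ≤ ν) :
    generalizationError μ f D ≤
      ν + ξ * ∑ r, max (((cellIndices C D r).ncard : ℝ) / n - μ.real (C r)) 0 := by
  have hn' : (0 : ℝ) < n := by exact_mod_cast hn
  obtain ⟨c, hc⟩ := exists_cell_index hdisj hcov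
  set p : Fin R → ℝ := fun r => μ.real (C r) with hpdef
  set w : Fin R → ℝ := fun r => ((cellIndices C D r).ncard : ℝ) / n with hwdef
  -- On null cells division by zero gives `a r = 0`, which is harmless since the integral vanishes
  -- too.
  set a : Fin R → ℝ := fun r => (∫ z in C r, f z ∂μ) / p r with hadef
  have hint : Integrable f μ := Integrable.of_bound hf.aestronglyMeasurable ξ
    (.of_forall fun z => by rw [Real.norm_eq_abs, abs_of_nonneg (h0 z)]; exact hξ z)
  have hp0 : ∀ r, 0 ≤ p r := fun r => measureReal_nonneg
  have hpa : ∀ r, ∫ z in C r, f z ∂μ = p r * a r := fun r => by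
    rcases eq_or_ne (p r) 0 with h | h
    · have h' : μ (C r) = 0 := (measureReal_eq_zero_iff).1 h
      rw [h, zero_mul, Measure.restrict_eq_zero.2 h', integral_zero_measure]
    · rw [hadef]; field_simp
  have hbound : ∀ r b, 0 ≤ b → (∀ z ∈ C r, f z ≤ b) → a r ≤ b := fun r b hb hfb => by
    refine div_le_of_le_mul₀ (hp0 r) hb ?_
    calc ∫ z in C r, f z ∂μ ≤ ∫ _ in C r, b ∂μ :=
          setIntegral_mono_on hint.integrableOn (integrable_const b).integrableOn (hmeas r) hfb
      _ = b * p r := by rw [setIntegral_const, smul_eq_mul, mul_comm]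
  have ha0 : ∀ r, 0 ≤ a r := fun r => div_nonneg (integral_nonneg fun z => h0 z) (hp0 r)
  have hξ0 : 0 ≤ ξ := (h0 (D ⟨0, hn⟩)).trans (hξ _)
  have haξ : ∀ r, a r ≤ ξ := fun r => hbound r ξ hξ0 fun z _ => hξ z
  have hai : ∀ i, a (c (D i)) ≤ f (D i) + ν := fun i => by
    have hi : D i ∈ C (c (D i)) := (hc _ _).2 rfl
    have hν : 0 ≤ ν := (abs_nonneg _).trans (hrob i _ _ hi hi)
    refine hbound _ _ (add_nonneg (h0 _) hν) fun z hz => ?_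
    linarith [(abs_le.1 (hrob i z _ hi hz)).1]
  have htot : ∫ z, f z ∂μ = ∑ r, p r * a r := by
    simp_rw [← hpa]
    rw [← integral_iUnion_fintype hmeas hdisj fun r => hint.integrableOn, hcov,
      Measure.restrict_univ]
  have hp1 : ∑ r, p r = 1 := by
    have := measureReal_iUnion_fintype (μ := μ) hdisj hmeas
    rw [hcov] at this
    rw [← this]; simp
  have hw1 : ∑ r, w r = 1 := by
    rw [hwdef, ← Finset.sum_div, sum_ncard_cellIndices hdisj hcov, div_self hn'.ne']
  have hwa : ∑ r, w r * a r ≤ 1 / n * ∑ i, f (D i) + ν := by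
    have : ∑ r, w r * a r = 1 / n * ∑ i, a (c (D i)) := by
      rw [← sum_ncard_cellIndices_mul D a hc, Finset.mul_sum]
      refine Finset.sum_congr rfl fun r _ => ?_
      rw [hwdef]; ring
    rw [this]
    calc _ ≤ 1 / (n : ℝ) * ∑ i, (f (D i) + ν) := by
          gcongr with i
          exact hai i
      _ = _ := by
          rw [Finset.sum_add_distrib, mul_add]
          simp
          field_simp
  have hdiff : ∑ r, (p r - w r) * a r ≤ ξ * ∑ r, max (w r - p r) 0 := by
    -- Equal total masses trade underestimated cells for overestimated ones, and the latter are all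
    -- occupied.
    have hmax : ∑ r, max (p r - w r) 0 = ∑ r, max (w r - p r) 0 := by
      have : ∀ r, max (p r - w r) 0 = max (w r - p r) 0 + (p r - w r) := fun r => by
        rcases le_total (p r) (w r) with h | h
        · rw [max_eq_right (by linarith), max_eq_left (by linarith)]; ring
        · rw [max_eq_left (by linarith), max_eq_right (by linarith)]; ring
      simp_rw [this]
      rw [Finset.sum_add_distrib, Finset.sum_sub_distrib, hp1, hw1, sub_self, add_zero]
    rw [← hmax, Finset.mul_sum]
    refine Finset.sum_le_sum fun r _ => ?_
    calc _ ≤ max (p r - w r) 0 * a r := mul_le_mul_of_nonneg_right (le_max_left _ _) (ha0 r)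
      _ ≤ max (p r - w r) 0 * ξ := mul_le_mul_of_nonneg_left (haξ r) (le_max_right _ _)
      _ = _ := mul_comm _ _
  have hsplit : ∑ r, p r * a r = ∑ r, (p r - w r) * a r + ∑ r, w r * a r := by
    rw [← Finset.sum_add_distrib]
    exact Finset.sum_congr rfl fun r _ => by ring
  rw [generalizationError, htot, hsplit]
  linarith

/-- The data-dependent generalization bound for robust learning algorithms. -/
theorem IsRobustPartition.measure_pi_generalizationError_gt_le (hn : 0 < n)
    {loss : (Fin n → Z) → Z → ℝ} {ν : (Fin n → Z) → ℝ} {C : Fin R → Set Z}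
    (hC : IsRobustPartition loss ν C) (hmeas : ∀ D, Measurable (loss D))
    (h0 : ∀ D z, 0 ≤ loss D z) (hbdd : ∀ D, BddAbove (Set.range (loss D)))
    (μ : Measure Z) [IsProbabilityMeasure μ] {δ : ℝ} (hδ : 0 < δ) (hδ' : δ < 1) :
    (Measure.pi fun _ : Fin n => μ) {D | ¬ generalizationError μ (loss D) D ≤
      ν D + maxLoss (loss D) * √(2 * (occupiedCells C D).ncard * Real.log (R / δ) / n)} ≤
        ENNReal.ofReal δ := by
  obtain ⟨z₀⟩ : Nonempty Z := nonempty_of_isProbabilityMeasure μ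
  obtain ⟨c, -⟩ := exists_cell_index hC.disjoint hC.cover
  have hR : 0 < R := (c z₀).pos
  have hR1 : (1 : ℝ) ≤ R := by exact_mod_cast hR
  have hRδ : 0 < R / δ := by positivity
  have hL : 0 ≤ Real.log (R / δ) :=
    Real.log_nonneg ((one_le_div hδ).2 (hδ'.le.trans hR1))
  -- The cells do not depend on the sample, so a union bound applies, each cell failing with
  -- probability at most `exp (-log (R / δ)) = δ / R`. Monotonicity needs no measurability of the
  -- failure event.
  refine (measure_mono (t := ⋃ r, {D | μ.real (C r) +
        √(2 * ((({i | D i ∈ C r} : Set (Fin n)).ncard : ℝ) / n) * Real.log (R / δ) / n) <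
          (({i | D i ∈ C r} : Set (Fin n)).ncard : ℝ) / n}) ?_).trans ?_
  · intro D hD
    by_contra hgood
    simp only [Set.mem_iUnion, Set.mem_ofPred_eq, not_exists, not_lt] at hgood
    refine hD ?_
    have hξ : ∀ z, loss D z ≤ maxLoss (loss D) := le_ciSup (hbdd D)
    refine (generalizationError_le_of_partition hn μ hC.measurableSet hC.disjoint hC.cover
      (hmeas D) (h0 D) hξ (hC.robust D)).trans ?_
    have hξ0 := (h0 D z₀).trans (hξ z₀)
    have := sum_max_frequency_sub_le (D := D) hn hC.disjoint hC.cover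
      (p := fun r => μ.real (C r)) (fun r => measureReal_nonneg) hL hgood
    gcongr
  · refine (measure_iUnion_le _).trans ?_
    rw [tsum_fintype]
    calc _ ≤ ∑ _r : Fin R, ENNReal.ofReal (Real.exp (-Real.log (R / δ))) :=
          Finset.sum_le_sum fun r _ => measure_pi_lt_frequency_le hn μ (hC.measurableSet r) _
      _ = ENNReal.ofReal δ := by
          rw [Real.exp_neg, Real.exp_log hRδ, Finset.sum_const, Finset.card_univ,
            Fintype.card_fin, nsmul_eq_mul, ← ENNReal.ofReal_natCast,
            ← ENNReal.ofReal_mul (by positivity)]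
          congr 1
          field_simp

end Concentration

/-! ### Constants and the final bound -/

/-- Because `2 * K / δ ≥ 1` and `s ≥ 1`, this prefactor may be raised to the power `s`, which brings
the whole quotient under one `s`-th power. -/
theorem log_floor_div_le {K V ε δ : ℝ} {s : ℕ} (hK : 1 ≤ K) (hε : 0 < ε) (hV : ε ≤ 28 * V)
    (hδ : 0 < δ) (hδ' : δ < 1) (hs : 1 ≤ s) :
    Real.log (⌊K * (28 * V / ε) ^ s⌋₊ / δ) ≤ s * Real.log (56 * K * V / (ε * δ)) := by
  have ha : 1 ≤ 28 * V / ε := (one_le_div hε).2 hV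
  have h1 : 1 ≤ K * (28 * V / ε) ^ s := one_le_mul_of_one_le_of_one_le hK (one_le_pow₀ ha)
  have hfl : (1 : ℝ) ≤ ⌊K * (28 * V / ε) ^ s⌋₊ := by
    exact_mod_cast Nat.one_le_floor_iff _ |>.2 h1
  have hKδ : 1 ≤ 2 * K / δ := (one_le_div hδ).2 (by linarith)
  rw [← Real.log_pow]
  refine Real.log_le_log (by positivity) ?_
  calc _ ≤ K * (28 * V / ε) ^ s / δ := by
        gcongr
        exact Nat.floor_le (by linarith)
    _ ≤ 2 * K / δ * (28 * V / ε) ^ s := by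
        rw [mul_div_right_comm]
        gcongr
        linarith
    _ ≤ (2 * K / δ) ^ s * (28 * V / ε) ^ s := by
        gcongr
        exact le_self_pow₀ hKδ (by omega)
    _ = _ := by
        rw [← mul_pow]
        congr 1
        field_simp
        ring

/-- Robustness of a quantum classifier trained by an arbitrary algorithm `𝒜`, and the resulting
generalization bound, which holds outside an event of probability at most `δ`. -/
theorem lemma3 {X : Type*} [MeasurableSpace X] {Θ : Type*} {N m K n : ℕ}
    (Q : QuantumClassifier X Θ N m K)
    (ℓ : EuclideanSpace ℝ (Fin K) → Fin K → ℝ) (hℓ : ∀ a y, 0 ≤ ℓ a y)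
    (L₁ : ℝ≥0)
    (hL₁ : ∀ θ y, LipschitzOnWith L₁ (fun a => ℓ a y) (Set.range (Q.predict θ)))
    (C₂ : ℝ) (hC₂ : ∀ θ k, matrixOpNorm (Q.observable θ k) ≤ C₂)
    (Nge : ℕ) (hNge : Q.encoding.numVariational = Nge) (hNge_pos : 1 ≤ Nge)
    (ε : ℝ) (hε : 0 < ε) (hε' : ε ≤ 28 * Nge)
    (hn : 1 ≤ n) (𝒜 : (Fin n → X × Fin K) → Θ)
    (R : ℕ) (hR : R = ⌊(K : ℝ) * (28 * Nge / ε) ^ (4 ^ m * Nge)⌋₊) :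
    IsRobust R (fun D => Q.loss ℓ (𝒜 D)) (fun _ => 4 * L₁ * K * C₂ * ε) ∧
    ∀ C : Fin R → Set (X × Fin K),
      IsRobustPartition (fun D => Q.loss ℓ (𝒜 D)) (fun _ => 4 * L₁ * K * C₂ * ε) C →
      ∀ (μ : Measure (X × Fin K)) [IsProbabilityMeasure μ] (δ : ℝ), 0 < δ → δ < 1 →
        (Measure.pi fun _ : Fin n => μ)
          {D | ¬ (generalizationError μ (Q.loss ℓ (𝒜 D)) D ≤
                4 * L₁ * K * C₂ * ε
                + 3 * maxLoss (Q.loss ℓ (𝒜 D)) *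
                    √((occupiedCells C D).ncard * 4 ^ m * Nge *
                      Real.log (56 * K * Nge / (ε * δ)) / n)
                + maxLoss (Q.loss ℓ (𝒜 D)) *
                    (2 * (occupiedCells C D).ncard * 4 ^ m * Nge *
                      Real.log (56 * K * Nge / (ε * δ)) / n)
              ∧ generalizationError μ (Q.loss ℓ (𝒜 D)) D ≤
                4 * L₁ * K * C₂ * ε
                + 5 * maxLoss (Q.loss ℓ (𝒜 D)) *
                    √((occupiedCells C D).ncard * 4 ^ m * Nge *
                      Real.log (56 * K * Nge / (ε * δ)) / n))} ≤ ENNReal.ofReal δ := by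

  subst hNge
  refine ⟨Q.isRobust 𝒜 hL₁ hC₂ hNge_pos hε hε' hR, fun C hC μ _ δ hδ hδ' => ?_⟩
  set V := Q.encoding.numVariational
  have hn' : (0 : ℝ) < n := by exact_mod_cast hn
  obtain ⟨x₀, y₀⟩ : Nonempty (X × Fin K) := nonempty_of_isProbabilityMeasure μ
  have hK : (1 : ℝ) ≤ K := by exact_mod_cast y₀.pos
  have hlog : Real.log (R / δ) ≤ 4 ^ m * V * Real.log (56 * K * V / (ε * δ)) := by
    have := log_floor_div_le (s := 4 ^ m * V) hK hε hε' hδ hδ'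
      (Nat.one_le_iff_ne_zero.2 (Nat.mul_ne_zero (by positivity) (by omega)))
    rw [← hR] at this
    exact_mod_cast this
  have hlog0 : 0 ≤ Real.log (56 * K * V / (ε * δ)) := by
    have h28 : ε * δ ≤ 28 * V := (mul_le_of_le_one_right hε.le hδ'.le).trans hε'
    refine Real.log_nonneg ((one_le_div (by positivity)).2 (h28.trans ?_))
    nlinarith [(Nat.cast_nonneg V : (0 : ℝ) ≤ V)]
  have hbdd : ∀ D, BddAbove (Set.range (Q.loss ℓ (𝒜 D))) := fun D =>
    Q.bddAbove_range_loss hℓ (hL₁ _) (hC₂ _)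
  refine (measure_mono ?_).trans
    (hC.measure_pi_generalizationError_gt_le hn (fun D => Q.measurable_loss (hL₁ _))
      (fun D z => hℓ _ _) hbdd μ hδ hδ')
  intro D hD hgen
  refine hD ?_
  have hξ : 0 ≤ maxLoss (Q.loss ℓ (𝒜 D)) := Real.iSup_nonneg fun z => hℓ _ _
  set T : ℝ := ((occupiedCells C D).ncard : ℝ) with hT
  have hT0 : 0 ≤ T := Nat.cast_nonneg _
  set B := T * 4 ^ m * V * Real.log (56 * K * V / (ε * δ)) / n with hB
  have hB0 : 0 ≤ B := by positivity
  -- The true constant is `√2`. Relaxing it to 3 already yields both bounds: the linear term of the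
  -- first is nonnegative, and `3 ≤ 5` gives the second.
  have hsqrt : √(2 * T * Real.log (R / δ) / n) ≤ 3 * √B := by
    rw [show (3 : ℝ) = √(3 ^ 2) by simp, ← Real.sqrt_mul (by positivity)]
    refine Real.sqrt_le_sqrt ?_
    calc 2 * T * Real.log (R / δ) / n
        ≤ 2 * T * (4 ^ m * V * Real.log (56 * K * V / (ε * δ))) / n := by gcongr
      _ = 2 * B := by rw [hB]; ring
      _ ≤ 3 ^ 2 * B := by linarith
  have hmain : generalizationError μ (Q.loss ℓ (𝒜 D)) D ≤
      4 * L₁ * K * C₂ * ε + 3 * maxLoss (Q.loss ℓ (𝒜 D)) * √B := by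
    refine hgen.trans ((add_le_add_iff_left _).2 ?_)
    calc _ ≤ maxLoss (Q.loss ℓ (𝒜 D)) * (3 * √B) := mul_le_mul_of_nonneg_left hsqrt hξ
      _ = _ := by ring
  refine ⟨hmain.trans (le_add_of_nonneg_right (by positivity)), hmain.trans ?_⟩
  gcongr
  norm_num
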